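/- Let $n, d$ be natural numbers with $d \ge 9$, let $X \in \mathbb{R}^{n \times d}$ be a fixed design matrix of full column rank (rank $d$, so $n \ge d$), and let $\sigma \ge 0$. Consider the linear regression model $Y = X\theta + \varepsilon$ with $\varepsilon \sim \mathsf{N}(0, \sigma^2 I_{n\times n})$ and $\theta \in \mathbb{R}^d$, that is, the family of distributions $\mathcal{P}_X = \{\mathsf{N}(X\theta, \sigma^2 I_{n \times n}) : \theta \in \mathbb{R}^d\}$ on $\mathbb{R}^n$, with $\theta(P)$ denoting the (unique) $\theta$ such that $P = \mathsf{N}(X\theta, \sigma^2 I_{n\times n})$. Let $$\mathfrak{M}_n(\theta(\mathcal{P}_X), \|\cdot\|_2^2) := \inf_{\hat\theta} \sup_{P \in \mathcal{P}_X} \mathbb{E}_{Y \sim P}\left[\|\hat\theta(Y) - \theta(P)\|_2^2\right] \in [0,\infty]$$ be the minimax risk, where the infimum ranges over all measurable functions $\hat\theta : \mathbb{R}^n \to \mathbb{R}^d$, and let $\gamma_{\max}(A)$ denote the maximum singular value of a matrix $A$. Then $$\mathfrak{M}_n(\theta(\mathcal{P}_X), \|\cdot\|_2^2) \ge \frac{1}{12}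 \cdot \frac{1}{\gamma_{\max}^2(X/\sqrt{n})} \cdot \frac{d\sigma^2}{n}.$$ -/

import Mathlib

open MeasureTheory ProbabilityTheory
open scoped ENNReal NNReal

namespace FanoMinimax

/-- The minimax risk `inf_{θ̂} sup_{P ∈ 𝓟} E_P[Φ(ρ(θ̂(Y), θ(P)))]` of a family `𝓟` of distributions
on the sample space `𝓨`, for one observation `Y ∼ P` (a whole data set is one point of `𝓨`).
The infimum ranges over all measurable estimators `θ̂ : 𝓨 → Θ`; the expectation is the
`[0, ∞]`-valued integral, so that an estimator without finite risk has risk `∞`. -/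
noncomputable def minimaxRisk {𝓨 Θ : Type*} [MeasurableSpace 𝓨] [MeasurableSpace Θ]
    (𝓟 : Set (Measure 𝓨)) (θ : Measure 𝓨 → Θ) (ρ : Θ → Θ → ℝ≥0) (Φ : ℝ≥0 → ℝ≥0) : ℝ≥0∞ :=
  ⨅ (est : 𝓨 → Θ) (_ : Measurable est), ⨆ P ∈ 𝓟, ∫⁻ y, (Φ (ρ (est y) (θ P)) : ℝ≥0∞) ∂P

/-- The law `N(Xθ, σ² I)` of `Y = Xθ + ε`, where `ε ∼ N(0, σ² I)` in `ℝⁿ`. -/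
noncomputable def regressionLaw {n d : ℕ} (X : Matrix (Fin n) (Fin d) ℝ) (σ : ℝ)
    (θ : EuclideanSpace ℝ (Fin d)) : Measure (EuclideanSpace ℝ (Fin n)) :=
  multivariateGaussian (Matrix.toEuclideanLin X θ) (σ ^ 2 • (1 : Matrix (Fin n) (Fin n) ℝ))

/-- The fixed-design linear regression family `{N(Xθ, σ² I) | θ ∈ ℝᵈ}`. -/
def regressionFamily {n d : ℕ} (X : Matrix (Fin n) (Fin d) ℝ) (σ : ℝ) :
    Set (Measure (EuclideanSpace ℝ (Fin n))) :=
  Set.range (regressionLaw X σ)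

/-- The parameter `θ(P)` of a member `P = N(Xθ, σ² I)` of the regression family. When `X` has full
column rank it is determined by `P`, see `regressionParam_regressionLaw`. -/
noncomputable def regressionParam {n d : ℕ} (X : Matrix (Fin n) (Fin d) ℝ) (σ : ℝ) :
    Measure (EuclideanSpace ℝ (Fin n)) → EuclideanSpace ℝ (Fin d) :=
  Function.invFun (regressionLaw X σ)

/-- For a design of full column rank, the parameter of the regression family is identifiable. -/
theorem regressionLaw_injective {n d : ℕ} (X : Matrix (Fin n) (Fin d) ℝ) (hX : X.rank = d)
    (σ : ℝ) : Function.Injective (regressionLaw X σ) := by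
  intro a b hab
  have hmean : Matrix.toEuclideanLin X a = Matrix.toEuclideanLin X b := by
    have h := congrArg (fun P : Measure (EuclideanSpace ℝ (Fin n)) => ∫ y, y ∂P) hab
    simpa only [regressionLaw, integral_id_multivariateGaussian] using h
  have hinj : Function.Injective X.mulVec := by
    rw [Matrix.mulVec_injective_iff, linearIndependent_iff_card_eq_finrank_span,
      Set.finrank, ← Matrix.rank_eq_finrank_span_cols, hX, Fintype.card_fin]
  apply WithLp.ofLp_injective
  apply hinj
  simpa [Matrix.ofLp_toLpLin] using congrArg WithLp.ofLp hmean

theorem regressionParam_regressionLaw {n d : ℕ} (X : Matrix (Fin n) (Fin d) ℝ) (hX : X.rank = d)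
    (σ : ℝ) (θ : EuclideanSpace ℝ (Fin d)) :
    regressionParam X σ (regressionLaw X σ θ) = θ :=
  Function.leftInverse_invFun (regressionLaw_injective X hX σ) θ

/-- The maximum singular value of a real matrix (singular values are listed in decreasing
order, starting at index `0`). -/
noncomputable def maxSingularValue {n d : ℕ} (A : Matrix (Fin n) (Fin d) ℝ) : ℝ :=
  (Matrix.toEuclideanLin A).singularValues 0

end FanoMinimax

/-! The bound follows from Assouad's method. The supremum over `θ` dominates the average over the
vertices of the cube `{-δ, δ}ᵈ`, and the squared error splits into coordinates. Pairing the vertices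
across the `j`-th edges leaves a two-point problem for each `j` (`regressionLaw_two_point`): the two
laws are shifts by `±δ X eⱼ` of one Gaussian centred at the edge midpoint. Since `‖X eⱼ‖² ≤ n γ²`,
where `γ` is the top singular value of `X/√n`, taking `δ = σ/(√n γ)` keeps them close enough that
each coordinate costs `δ²/12` on average. Summing over `j` gives `d δ²/12`. -/

namespace FanoMinimax

/-! ### Two-point bound and Gaussian shifts -/

/-- Le Cam's two-point bound for the squared error, for two probability measures whose densities
with respect to a third one have a constant product. -/
theorem two_point_sq_le {Ω : Type*} [MeasurableSpace Ω] {ν : Measure Ω} [IsProbabilityMeasure ν]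
    {p q : Ω → ℝ} (hp : Measurable p) (hq : Measurable q) (hp0 : ∀ x, 0 < p x)
    (hq0 : ∀ x, 0 < q x) {k : ℝ} (hpq : ∀ x, p x * q x = k)
    (hP : (∫⁻ x, ENNReal.ofReal (p x) ∂ν) = 1) (hQ : (∫⁻ x, ENNReal.ofReal (q x) ∂ν) = 1)
    {f : Ω → ℝ} (hf : Measurable f) (s t : ℝ) :
    ENNReal.ofReal ((s - t) ^ 2 / 2 * k) ≤
      ∫⁻ x, ENNReal.ofReal ((f x - s) ^ 2) ∂(ν.withDensity fun x => ENNReal.ofReal (p x)) +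
      ∫⁻ x, ENNReal.ofReal ((f x - t) ^ 2) ∂(ν.withDensity fun x => ENNReal.ofReal (q x)) := by
  rw [lintegral_withDensity_eq_lintegral_mul _ (by fun_prop) (by fun_prop),
    lintegral_withDensity_eq_lintegral_mul _ (by fun_prop) (by fun_prop)]
  simp only [Pi.mul_apply]
  obtain ⟨x₀⟩ : Nonempty Ω := nonempty_of_isProbabilityMeasure ν
  have hk : 0 < k := hpq x₀ ▸ mul_pos (hp0 x₀) (hq0 x₀)
  have hD : 0 ≤ (s - t) ^ 2 * k := by positivity
  -- Minimising over `f x` gives the weighted error at least `(s - t)² k / (p + q)`, and the tangent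
  -- line of `1/S` at `S = 2` gives `1/S ≥ 1 - S/4`. The bound is then linear in `p + q`, whose
  -- integral is `2`.
  have key : ∀ x, ENNReal.ofReal ((s - t) ^ 2 * k) ≤
      (ENNReal.ofReal (p x) * ENNReal.ofReal ((f x - s) ^ 2) +
        ENNReal.ofReal (q x) * ENNReal.ofReal ((f x - t) ^ 2)) +
      ENNReal.ofReal ((s - t) ^ 2 * k / 4) * (ENNReal.ofReal (p x) + ENNReal.ofReal (q x)) := by
    intro x
    have h1 := hp0 x
    have h2 := hq0 x
    rw [← ENNReal.ofReal_mul h1.le, ← ENNReal.ofReal_mul h2.le,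
      ← ENNReal.ofReal_add (by positivity) (by positivity),
      ← ENNReal.ofReal_add h1.le h2.le, ← ENNReal.ofReal_mul (by positivity),
      ← ENNReal.ofReal_add (by positivity) (by positivity)]
    apply ENNReal.ofReal_le_ofReal
    rw [← hpq x]
    have hS : 0 < p x + q x := by positivity
    set W := p x * (f x - s) ^ 2 + q x * (f x - t) ^ 2
    have hW : (s - t) ^ 2 * (p x * q x) ≤ (p x + q x) * W := by
      have : (p x + q x) * W - (s - t) ^ 2 * (p x * q x) =
          (p x * (f x - s) + q x * (f x - t)) ^ 2 := by simp only [W]; ring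
      nlinarith [sq_nonneg (p x * (f x - s) + q x * (f x - t))]
    have hM : 0 ≤ (s - t) ^ 2 * (p x * q x) := by positivity
    set M := (s - t) ^ 2 * (p x * q x)
    refine le_of_mul_le_mul_left ?_ hS
    -- Uses `S (4 - S) ≤ 4`, that is `(S - 2)² ≥ 0`.
    nlinarith [mul_nonneg hM (sq_nonneg (p x + q x - 2))]
  have h := lintegral_mono (μ := ν) key
  rw [lintegral_const, measure_univ, mul_one, lintegral_add_left (by fun_prop),
    lintegral_add_left (by fun_prop), lintegral_const_mul _ (by fun_prop),
    lintegral_add_left (by fun_prop), hP, hQ, one_add_one_eq_two,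
    show (2 : ℝ≥0∞) = ENNReal.ofReal 2 by simp, ← ENNReal.ofReal_mul (by positivity)] at h
  have h4 : ENNReal.ofReal ((s - t) ^ 2 * k) =
      ENNReal.ofReal ((s - t) ^ 2 / 2 * k) + ENNReal.ofReal ((s - t) ^ 2 * k / 4 * 2) := by
    rw [← ENNReal.ofReal_add (by positivity) (by positivity)]
    congr 1; ring
  rw [h4] at h
  exact (ENNReal.add_le_add_iff_right ENNReal.ofReal_ne_top).1 h

/-- On boxes, independence of the coordinates turns the integral of the product into the product of
the integrals. -/
theorem pi_withDensity {ι : Type*} [Fintype ι] {μ : ι → Measure ℝ}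
    [∀ i, IsProbabilityMeasure (μ i)] {g : ι → ℝ → ℝ≥0∞} (hg : ∀ i, Measurable (g i))
    [∀ i, SigmaFinite ((μ i).withDensity (g i))] :
    Measure.pi (fun i => (μ i).withDensity (g i)) =
      (Measure.pi μ).withDensity fun x => ∏ i, g i (x i) := by
  refine Measure.pi_eq fun s hs => ?_
  rw [withDensity_apply _ (MeasurableSet.univ_pi hs), ← lintegral_indicator (MeasurableSet.univ_pi hs)]
  have h1 : ∀ x : ι → ℝ, (Set.univ.pi s).indicator (fun x => ∏ i, g i (x i)) x =
      ∏ i, (s i).indicator (g i) (x i) := by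
    intro x
    by_cases hx : x ∈ Set.univ.pi s
    · rw [Set.indicator_of_mem hx]
      exact Finset.prod_congr rfl fun i _ => (Set.indicator_of_mem (hx i (Set.mem_univ i)) _).symm
    · rw [Set.indicator_of_notMem hx]
      simp only [Set.mem_pi, Set.mem_univ, true_imp_iff, not_forall] at hx
      obtain ⟨i, hi⟩ := hx
      exact (Finset.prod_eq_zero (Finset.mem_univ i) (Set.indicator_of_notMem hi _)).symm
  simp_rw [h1]
  have hm : ∀ i, Measurable ((s i).indicator (g i)) := fun i => (hg i).indicator (hs i)
  rw [lintegral_prod_eq_prod_lintegral_of_indepFun Finset.univ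
    (fun i (x : ι → ℝ) => (s i).indicator (g i) (x i))
    (iIndepFun_pi (X := fun i => (s i).indicator (g i)) fun i => (hm i).aemeasurable)
    (fun i => (hm i).comp (measurable_pi_apply i))]
  refine Finset.prod_congr rfl fun i _ => ?_
  rw [(measurePreserving_eval μ i).lintegral_comp (hm i), lintegral_indicator (hs i),
    withDensity_apply _ (hs i)]

theorem gaussianReal_one_eq_withDensity (a : ℝ) :
    gaussianReal a 1 =
      (gaussianReal 0 1).withDensity fun x => ENNReal.ofReal (Real.exp (a * x - a ^ 2 / 2)) := by
  rw [gaussianReal_of_var_ne_zero _ one_ne_zero, gaussianReal_of_var_ne_zero _ one_ne_zero,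
    ← withDensity_mul _ (by fun_prop) (by fun_prop)]
  congr 1
  ext x
  rw [Pi.mul_apply, gaussianPDF, gaussianPDF, ← ENNReal.ofReal_mul (gaussianPDFReal_nonneg _ _ _),
    gaussianPDFReal, gaussianPDFReal, mul_assoc (√_)⁻¹, ← Real.exp_add]
  congr 3
  simp only [NNReal.coe_one]
  ring

/-- The Cameron–Martin density of a shifted standard Gaussian vector. -/
noncomputable def shiftDensity {ι : Type*} [Fintype ι] (a x : ι → ℝ) : ℝ :=
  Real.exp (∑ i, (a i * x i - a i ^ 2 / 2))

theorem measurable_shiftDensity {ι : Type*} [Fintype ι] (a : ι → ℝ) :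
    Measurable (shiftDensity a) := by
  unfold shiftDensity
  fun_prop

theorem pi_gaussianReal_eq_withDensity {ι : Type*} [Fintype ι] (a : ι → ℝ) :
    Measure.pi (fun i => gaussianReal (a i) 1) =
      (Measure.pi fun _ => gaussianReal 0 1).withDensity
        fun x => ENNReal.ofReal (shiftDensity a x) := by
  have hfin : ∀ i, SigmaFinite ((gaussianReal 0 1).withDensity
      fun x => ENNReal.ofReal (Real.exp (a i * x - a i ^ 2 / 2))) := fun i => by
    rw [← gaussianReal_one_eq_withDensity]; infer_instance
  simp_rw [gaussianReal_one_eq_withDensity (a _), shiftDensity, Real.exp_sum]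
  rw [pi_withDensity (fun i => by fun_prop)]
  congr 1
  ext x
  rw [ENNReal.ofReal_prod_of_nonneg fun i _ => (Real.exp_pos _).le]

theorem lintegral_shiftDensity {ι : Type*} [Fintype ι] (a : ι → ℝ) :
    (∫⁻ x, ENNReal.ofReal (shiftDensity a x) ∂(Measure.pi fun _ : ι => gaussianReal 0 1)) = 1 := by
  rw [← setLIntegral_univ, ← withDensity_apply _ MeasurableSet.univ,
    ← pi_gaussianReal_eq_withDensity, measure_univ]

open scoped MatrixOrder Matrix.Norms.L2Operator in
theorem multivariateGaussian_sq_smul_one {n : ℕ} {σ : ℝ} (hσ : 0 ≤ σ)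
    (c : EuclideanSpace ℝ (Fin n)) :
    multivariateGaussian c (σ ^ 2 • (1 : Matrix (Fin n) (Fin n) ℝ)) =
      (Measure.pi fun _ => gaussianReal 0 1).map (fun x => c + σ • WithLp.toLp 2 x) := by
  have hsqrt : CFC.sqrt (σ ^ 2 • (1 : Matrix (Fin n) (Fin n) ℝ)) = σ • 1 := by
    refine CFC.sqrt_unique ?_ (Matrix.PosSemidef.one.smul hσ).nonneg
    simp [smul_smul, sq]
  rw [multivariateGaussian, ← map_pi_eq_stdGaussian, Measure.map_map (by fun_prop) (by fun_prop),
    hsqrt]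
  congr 1
  ext x
  simp

/-- Both hypotheses become densities on one standard Gaussian space. Measured from the midpoint `c`,
the shifts `a` and `-a` have densities whose product is the constant `exp(-∑ aᵢ²)`. -/
theorem multivariateGaussian_shift {n : ℕ} {σ : ℝ} (hσ : 0 ≤ σ)
    (c : EuclideanSpace ℝ (Fin n)) (a : Fin n → ℝ) :
    multivariateGaussian (c + σ • WithLp.toLp 2 a) (σ ^ 2 • (1 : Matrix (Fin n) (Fin n) ℝ)) =
      ((Measure.pi fun _ => gaussianReal 0 1).withDensity
        fun x => ENNReal.ofReal (shiftDensity a x)).map (fun x => c + σ • WithLp.toLp 2 x) := by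
  have h : Measure.pi (fun i => gaussianReal (a i) 1) =
      (Measure.pi fun _ => gaussianReal 0 1).map (fun x => fun i => x i + a i) := by
    rw [Measure.pi_map_pi (f := fun i y => y + a i) (fun i => by fun_prop)]
    simp_rw [gaussianReal_map_add_const, zero_add]
  rw [multivariateGaussian_sq_smul_one hσ, ← pi_gaussianReal_eq_withDensity, h,
    Measure.map_map (by fun_prop) (by fun_prop)]
  congr 1
  ext x i
  simp
  ring

/-- Two-point lower bound for the squared error in the Gaussian location model. -/
theorem gaussian_two_point {n : ℕ} {σ : ℝ} (hσ : 0 ≤ σ)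
    (c : EuclideanSpace ℝ (Fin n)) (a : Fin n → ℝ) {f : EuclideanSpace ℝ (Fin n) → ℝ}
    (hf : Measurable f) (s t : ℝ) :
    ENNReal.ofReal ((s - t) ^ 2 / 2 * Real.exp (-∑ i, a i ^ 2)) ≤
      ∫⁻ y, ENNReal.ofReal ((f y - s) ^ 2) ∂(multivariateGaussian (c + σ • WithLp.toLp 2 a)
        (σ ^ 2 • (1 : Matrix (Fin n) (Fin n) ℝ))) +
      ∫⁻ y, ENNReal.ofReal ((f y - t) ^ 2) ∂(multivariateGaussian (c - σ • WithLp.toLp 2 a)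
        (σ ^ 2 • (1 : Matrix (Fin n) (Fin n) ℝ))) := by
  have hneg : c - σ • WithLp.toLp 2 a = c + σ • WithLp.toLp 2 (-a) := by
    rw [WithLp.toLp_neg, smul_neg, sub_eq_add_neg]
  rw [hneg, multivariateGaussian_shift hσ, multivariateGaussian_shift hσ,
    lintegral_map (by fun_prop) (by fun_prop), lintegral_map (by fun_prop) (by fun_prop)]
  refine two_point_sq_le (f := fun x => f (c + σ • WithLp.toLp 2 x)) (measurable_shiftDensity a)
    (measurable_shiftDensity (-a)) (fun x => Real.exp_pos _) (fun x => Real.exp_pos _)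
    (fun x => ?_) (lintegral_shiftDensity a) (lintegral_shiftDensity (-a)) (by fun_prop) s t
  rw [shiftDensity, shiftDensity, ← Real.exp_add, ← Finset.sum_add_distrib,
    ← Finset.sum_neg_distrib]
  congr 1
  refine Finset.sum_congr rfl fun i _ => ?_
  simp only [Pi.neg_apply]
  ring

/-! ### Singular values and the regression two-point bound -/

/-- Expand `⟪x, T*T x⟫` in an eigenbasis of `T*T`: its eigenvalues are the squared singular values,
the largest having index `0`. -/
theorem sq_norm_apply_le_sq_singularValues_zero {E F : Type*} [NormedAddCommGroup E]
    [InnerProductSpace ℝ E] [FiniteDimensional ℝ E] [NormedAddCommGroup F] [InnerProductSpace ℝ F]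
    [FiniteDimensional ℝ F] (T : E →ₗ[ℝ] F) (x : E) :
    ‖T x‖ ^ 2 ≤ T.singularValues 0 ^ 2 * ‖x‖ ^ 2 := by
  set hs := T.isSymmetric_adjoint_comp_self
  set b := hs.eigenvectorBasis rfl
  have h1 : ‖T x‖ ^ 2 = inner ℝ x ((LinearMap.adjoint T ∘ₗ T) x) := by
    rw [LinearMap.comp_apply, LinearMap.adjoint_inner_right, real_inner_self_eq_norm_sq]
  rw [h1, ← b.sum_inner_mul_inner, ← b.sum_sq_norm_inner_right x, Finset.mul_sum]
  refine Finset.sum_le_sum fun i _ => ?_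
  rw [← hs (b i) x, hs.apply_eigenvectorBasis, ← T.sq_singularValues_fin rfl i]
  simp only [RCLike.ofReal_real_eq_id, id, real_inner_smul_left, Real.norm_eq_abs, sq_abs]
  rw [real_inner_comm x (b i)]
  have := T.singularValues_antitone (Nat.zero_le (i : ℕ))
  have h0 := T.singularValues_nonneg i
  nlinarith [mul_le_mul_of_nonneg_right (pow_le_pow_left₀ h0 this 2) (sq_nonneg (inner ℝ x (b i)))]

/-- Two-point bound along the `j`-th coordinate of the regression parameter. -/
theorem regressionLaw_two_point {n d : ℕ} (X : Matrix (Fin n) (Fin d) ℝ) {σ : ℝ} (hσ : 0 < σ)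
    (u : EuclideanSpace ℝ (Fin d)) (j : Fin d) {s : ℝ}
    (hs : s ^ 2 * ‖Matrix.toEuclideanLin X (EuclideanSpace.single j 1)‖ ^ 2 ≤ σ ^ 2)
    {f : EuclideanSpace ℝ (Fin n) → ℝ} (hf : Measurable f) :
    ENNReal.ofReal (s ^ 2 / 6) ≤
      ∫⁻ y, ENNReal.ofReal ((f y - s) ^ 2) ∂(regressionLaw X σ (u + s • EuclideanSpace.single j 1)) +
      ∫⁻ y, ENNReal.ofReal ((f y - -s) ^ 2)
        ∂(regressionLaw X σ (u - s • EuclideanSpace.single j 1)) := by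
  set w := Matrix.toEuclideanLin X (EuclideanSpace.single j 1) with hw
  have ha : σ • WithLp.toLp 2 (fun i => s / σ * w i) = s • w := by
    ext i
    simp only [PiLp.smul_apply, smul_eq_mul]
    field_simp
  have key := gaussian_two_point hσ.le (Matrix.toEuclideanLin X u) (fun i => s / σ * w i) hf s (-s)
  rw [ha] at key
  rw [regressionLaw, regressionLaw, map_add, map_sub, map_smul, ← hw]
  refine le_trans (ENNReal.ofReal_le_ofReal ?_) key
  have hsum : ∑ i, (s / σ * w i) ^ 2 ≤ 1 := by
    simp_rw [mul_pow]
    rw [← Finset.mul_sum, ← EuclideanSpace.real_norm_sq_eq, div_pow, div_mul_eq_mul_div]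
    exact div_le_one_of_le₀ hs (sq_nonneg σ)
  -- The separation `2s` gives `2 s² exp(-∑ ..)`. The crude bound `1/12 ≤ e⁻¹` is enough for `s²/6`.
  have hexp : (1 : ℝ) / 12 ≤ Real.exp (-∑ i, (s / σ * w i) ^ 2) := by
    refine le_trans ?_ (Real.exp_le_exp.2 (neg_le_neg hsum))
    linarith [Real.exp_neg_one_gt_d9]
  nlinarith [mul_le_mul_of_nonneg_left hexp (sq_nonneg s)]

theorem coe_nndist_sq_eq_sum {d : ℕ} (x y : EuclideanSpace ℝ (Fin d)) :
    ((nndist x y ^ 2 : ℝ≥0) : ℝ≥0∞) = ∑ j, ENNReal.ofReal ((x j - y j) ^ 2) := by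
  rw [← ENNReal.ofReal_sum_of_nonneg fun j _ => sq_nonneg _, ← ENNReal.ofReal_coe_nnreal]
  congr 1
  rw [NNReal.coe_pow, coe_nndist, EuclideanSpace.dist_eq,
    Real.sq_sqrt (Finset.sum_nonneg fun j _ => sq_nonneg _)]
  simp [Real.dist_eq]

/-! ### Assouad's hypercube argument -/

/-- The vertices of the hypercube `{-δ, δ}ᵈ`. -/
noncomputable def cubeVertex {d : ℕ} (δ : ℝ) (v : Fin d → Bool) : EuclideanSpace ℝ (Fin d) :=
  WithLp.toLp 2 fun j => if v j then δ else -δ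

/-- Negating the `j`-th bit. -/
def flipBit {d : ℕ} (j : Fin d) (v : Fin d → Bool) : Fin d → Bool :=
  Function.update v j (!v j)

theorem flipBit_involutive {d : ℕ} (j : Fin d) : Function.Involutive (flipBit j) := by
  intro v
  simp [flipBit]

theorem cubeVertex_flipBit {d : ℕ} (δ : ℝ) (j : Fin d) (v : Fin d → Bool) :
    cubeVertex δ (flipBit j v) = cubeVertex δ v -
      (2 * cubeVertex δ v j) • EuclideanSpace.single j 1 := by
  ext i
  by_cases h : i = j
  · subst h
    cases hv : v i <;> simp [cubeVertex, flipBit, hv] <;> ring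
  · cases hv : v j <;> simp [cubeVertex, flipBit, h, hv]

/-- **Assouad's method** for the Gaussian regression model: a lower bound for the sum of the
squared risks over the vertices of a sufficiently small hypercube. -/
theorem assouad_regression {n d : ℕ} (X : Matrix (Fin n) (Fin d) ℝ) {σ : ℝ} (hσ : 0 < σ) {δ : ℝ}
    (hδ : ∀ j, δ ^ 2 * ‖Matrix.toEuclideanLin X (EuclideanSpace.single j 1)‖ ^ 2 ≤ σ ^ 2)
    {est : EuclideanSpace ℝ (Fin n) → EuclideanSpace ℝ (Fin d)} (hest : Measurable est) :
    2 ^ d * ENNReal.ofReal (d * δ ^ 2 / 12) ≤ ∑ v : Fin d → Bool,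
      ∫⁻ y, ((nndist (est y) (cubeVertex δ v) ^ 2 : ℝ≥0) : ℝ≥0∞)
        ∂(regressionLaw X σ (cubeVertex δ v)) := by
  have hm : ∀ j, Measurable fun y => est y j := fun j => by fun_prop
  simp_rw [coe_nndist_sq_eq_sum]
  simp_rw [lintegral_finsetSum' Finset.univ (fun (j : Fin d) _ =>
    (((hm j).sub_const _).pow_const 2).ennreal_ofReal.aemeasurable)]
  rw [Finset.sum_comm]
  set r : Fin d → (Fin d → Bool) → ℝ≥0∞ := fun j v =>
    ∫⁻ y, ENNReal.ofReal ((est y j - cubeVertex δ v j) ^ 2) ∂(regressionLaw X σ (cubeVertex δ v))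
  have hpair : ∀ j v, ENNReal.ofReal (δ ^ 2 / 6) ≤ r j v + r j (flipBit j v) := by
    intro j v
    have hsq : cubeVertex δ v j ^ 2 = δ ^ 2 := by
      cases hv : v j <;> simp [cubeVertex, hv]
    have hflip : cubeVertex δ (flipBit j v) j = -cubeVertex δ v j := by
      rw [cubeVertex_flipBit]; simp; ring
    -- The base point is the midpoint of the edge, and `s` is the signed coordinate `±δ`, so one
    -- statement covers both endpoints.
    have := regressionLaw_two_point X hσ
      (cubeVertex δ v - cubeVertex δ v j • EuclideanSpace.single j 1) j
      (s := cubeVertex δ v j) (by rw [hsq]; exact hδ j) (hm j)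
    rw [hsq, sub_add_cancel, sub_sub, ← add_smul, ← two_mul, ← cubeVertex_flipBit, ← hflip] at this
    exact this
  have hcoord : ∀ j, 2 ^ d * ENNReal.ofReal (δ ^ 2 / 12) ≤ ∑ v, r j v := by
    intro j
    -- Bit flipping permutes the vertices, so summing the pair bounds counts each risk twice and
    -- halves `δ²/6`.
    have h1 : ∑ v, r j (flipBit j v) = ∑ v, r j v :=
      Equiv.sum_comp (flipBit_involutive j).toPerm (r j)
    have h2 : ∑ _v : Fin d → Bool, ENNReal.ofReal (δ ^ 2 / 6) ≤
        ∑ v, (r j v + r j (flipBit j v)) := Finset.sum_le_sum fun v _ => hpair j v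
    rw [Finset.sum_add_distrib, h1, ← two_mul, Finset.sum_const, nsmul_eq_mul, Finset.card_univ,
      Fintype.card_fun, Fintype.card_bool, Fintype.card_fin,
      show δ ^ 2 / 6 = 2 * (δ ^ 2 / 12) by ring, ENNReal.ofReal_mul zero_le_two,
      ENNReal.ofReal_ofNat, mul_left_comm] at h2
    push_cast at h2
    exact (ENNReal.mul_le_mul_iff_right two_ne_zero ENNReal.ofNat_ne_top).1 h2
  calc 2 ^ d * ENNReal.ofReal (d * δ ^ 2 / 12)
      = ∑ _j : Fin d, 2 ^ d * ENNReal.ofReal (δ ^ 2 / 12) := by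
        rw [Finset.sum_const, Finset.card_univ, Fintype.card_fin, nsmul_eq_mul, mul_div_assoc,
          ENNReal.ofReal_mul (Nat.cast_nonneg d), ENNReal.ofReal_natCast, mul_left_comm]
    _ ≤ ∑ j, ∑ v, r j v := Finset.sum_le_sum fun j _ => hcoord j

theorem le_minimaxRisk_regression {n d : ℕ} (X : Matrix (Fin n) (Fin d) ℝ) (hX : X.rank = d)
    {σ : ℝ} (hσ : 0 < σ) {δ : ℝ}
    (hδ : ∀ j, δ ^ 2 * ‖Matrix.toEuclideanLin X (EuclideanSpace.single j 1)‖ ^ 2 ≤ σ ^ 2) :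
    ENNReal.ofReal (d * δ ^ 2 / 12) ≤
      minimaxRisk (regressionFamily X σ) (regressionParam X σ) nndist (fun t => t ^ 2) := by
  refine le_iInf₂ fun est hest => ?_
  set S := ⨆ P ∈ regressionFamily X σ,
    ∫⁻ y, ((nndist (est y) (regressionParam X σ P) ^ 2 : ℝ≥0) : ℝ≥0∞) ∂P
  have hS : ∀ θ, ∫⁻ y, ((nndist (est y) θ ^ 2 : ℝ≥0) : ℝ≥0∞) ∂(regressionLaw X σ θ) ≤ S := by
    intro θ
    refine le_trans (le_of_eq ?_) (le_iSup₂ (f := fun P (_ : P ∈ regressionFamily X σ) =>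
      ∫⁻ y, ((nndist (est y) (regressionParam X σ P) ^ 2 : ℝ≥0) : ℝ≥0∞) ∂P) _ ⟨θ, rfl⟩)
    rw [regressionParam_regressionLaw X hX]
  have h := (assouad_regression X hσ hδ hest).trans
    (Finset.sum_le_sum fun v _ => hS (cubeVertex δ v))
  rw [Finset.sum_const, nsmul_eq_mul, Finset.card_univ, Fintype.card_fun, Fintype.card_bool,
    Fintype.card_fin] at h
  push_cast at h
  exact (ENNReal.mul_le_mul_iff_right (by simp) (by simp)).1 h

end FanoMinimax

theorem mainTheorem8 (n d : ℕ) (hd : 9 ≤ d) (X : Matrix (Fin n) (Fin d) ℝ) (hX : X.rank = d)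
    (σ : ℝ) (hσ : 0 ≤ σ) :
    ENNReal.ofReal
        (1 / 12 * (1 / FanoMinimax.maxSingularValue ((Real.sqrt n)⁻¹ • X) ^ 2) * (d * σ ^ 2 / n)) ≤
      FanoMinimax.minimaxRisk (FanoMinimax.regressionFamily X σ) (FanoMinimax.regressionParam X σ)
        nndist (fun t => t ^ 2) := by
  rcases hσ.eq_or_lt with rfl | hσ
  · simp
  set g := FanoMinimax.maxSingularValue ((Real.sqrt n)⁻¹ • X)
  -- Here `1 / 0 = 0` makes the lower bound trivial.
  by_cases hg0 : g = 0
  · simp [hg0]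
  have hn : 0 < (n : ℝ) := by
    have := Matrix.rank_le_height X
    exact_mod_cast (by omega : 0 < n)
  -- This `δ` makes `δ² n g² = σ²`, the largest value that `‖X eⱼ‖² ≤ n g²` permits.
  have hδ : ∀ j, (σ / (√n * g)) ^ 2 *
      ‖Matrix.toEuclideanLin X (EuclideanSpace.single j 1)‖ ^ 2 ≤ σ ^ 2 := by
    intro j
    have h : _ ≤ g ^ 2 * _ := FanoMinimax.sq_norm_apply_le_sq_singularValues_zero
      (Matrix.toEuclideanLin ((Real.sqrt n)⁻¹ • X)) (EuclideanSpace.single j 1)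
    rw [map_smul, LinearMap.smul_apply, norm_smul, mul_pow, norm_inv, inv_pow, Real.norm_eq_abs,
      sq_abs, Real.sq_sqrt hn.le, PiLp.norm_single, norm_one,
      one_pow, mul_one, inv_mul_le_iff₀ hn] at h
    rw [div_pow, mul_pow, Real.sq_sqrt hn.le, div_mul_eq_mul_div, div_le_iff₀ (by positivity)]
    exact mul_le_mul_of_nonneg_left h (sq_nonneg σ)
  refine le_trans (le_of_eq ?_) (FanoMinimax.le_minimaxRisk_regression X hX hσ hδ)
  congr 1
  rw [div_pow, mul_pow, Real.sq_sqrt hn.le]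
  field_simp
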